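/- **Definitions.** Let $\kappa$ be an uncountable regular cardinal and let $J$ be the ideal of nonstationary subsets of $\kappa$. For functions $g,f$ from $\kappa$ to the ordinals write $g<_J f$ if $\{i<\kappa : g(i)\ge f(i)\}\in J$. This relation is well founded, and the Galvin--Hajnal rank is defined by $\|f\|_J=\sup\{\|g\|_J+1 : g<_J f\}$. For an ordinal $\gamma$, $\|\gamma\|_J$ is the rank of the function on $\kappa$ that is constant with value $\gamma$. Let $T$ be a first-order theory whose language contains a unary predicate $P$ and a binary relation symbol $<$, such that $T$ proves that $<$ is a linear order of the universe; $|T|$ denotes the cardinality of the language of $T$ (plus $\aleph_0$). For a set $\Gamma$ of types (sets of formulas in finitely many variables over the empty set), $EC(T,\Gamma)$ is the class of models of $T$ that omit every $p\in\Gamma$. For an ordinal $\gamma>\kappa$, $\delta_2(\gamma,\kappa)$ is the least ordinal $\delta$ such that for all such $T,\Gamma$ with $|T|\le\kappa$ and $|\Gamma|\le\kappa$: if for every $\delta'<\delta$ there is $M\in EC(T,\Gamma)$ such that $P^M$ is well ordered by $<^M$ with order type $<\gamma$ and $M\setminus P^M$ is well ordered by $<^M$ with order type $\ge\delta'$, then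 there is $N\in EC(T,\Gamma)$ such that $P^N$ is well ordered by $<^N$ with order type $<\kappa^+$ and $N\setminus P^N$ is not well ordered by $<^N$. (Such a $\delta$ exists; this is part of the claim.) **Theorem.** Let $\kappa$ be an uncountable regular cardinal and $J$ the ideal of nonstationary subsets of $\kappa$. For every ordinal $\gamma>\kappa$, $$\|\gamma\|_J<\delta_2(\gamma+1,\kappa);$$ that is, $\|\gamma\|_J$ is less than the ordinal defined like $\delta_2(\gamma,\kappa)$ but with the order type of $P^M$ allowed to be $\le\gamma$. Moreover, if $\gamma$ is a successor ordinal or $\operatorname{cf}(\gamma)>\kappa$, then $$\|\gamma\|_J<\delta_2(\gamma,\kappa).$$ -/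

import Mathlib

universe u

open Cardinal

namespace GHBound

/-! ### Reduction modulo an ideal and the Galvin-Hajnal rank -/

/-- The ideal of nonstationary subsets of `κ`, the cardinal `κ` being identified with the
well-order `κ.ord.ToType` of the ordinals below it. -/
def nonstationaryIdeal (κ : Cardinal.{u}) : Set (Set κ.ord.ToType) :=
  {A | ¬ IsStationary A}

/-- `g <_J f`: the set of the indices at which `g i < f i` fails belongs to `J`. -/
def LtMod {I : Type u} (J : Set (Set I)) {o : Ordinal.{u}} (g f : I → o.ToType) : Prop :=
  {i | ¬ g i < f i} ∈ J

/-- The nonstationary ideal on an uncountable regular cardinal is `ℵ₁`-complete, hence `<_J` is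
well founded. -/
theorem ltMod_nonstationary_isWellFounded {κ : Cardinal.{u}} (hreg : κ.IsRegular) (hκ : ℵ₀ < κ)
    (o : Ordinal.{u}) :
    IsWellFounded (κ.ord.ToType → o.ToType) (LtMod (nonstationaryIdeal κ)) := by
  refine ⟨?_⟩
  rw [wellFounded_iff_isEmpty_descending_chain]
  refine ⟨fun ⟨f, hf⟩ => ?_⟩
  have hcof : Order.cof κ.ord.ToType ≠ ℵ₀ := by
    rw [Ordinal.cof_toType, hreg.cof_ord]
    exact hκ.ne'
  have hne : Nonempty κ.ord.ToType := by
    rw [Ordinal.nonempty_toType_iff]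
    intro h
    rw [Cardinal.ord_eq_zero] at h
    simp [h] at hκ
  have hU : ¬ IsStationary (⋃ n, {i | ¬ f (n + 1) i < f n i}) := by
    rw [isStationary_iUnion_iff_of_countable hcof]
    rintro ⟨n, hn⟩
    exact hf n hn
  have hx : ∃ i, i ∉ ⋃ n, {i | ¬ f (n + 1) i < f n i} := by
    by_contra h
    refine hU ?_
    rw [Set.eq_univ_of_forall (not_exists_not.1 h)]
    exact IsStationary.univ
  obtain ⟨i, hi⟩ := hx
  simp only [Set.mem_iUnion, Set.mem_ofPred_eq, not_exists, not_not] at hi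
  exact (wellFounded_iff_isEmpty_descending_chain.1
    (wellFounded_lt (α := o.ToType))).false ⟨fun n => f n i, hi⟩

/-- The Galvin-Hajnal rank of `f` modulo `J`: the rank of `f` in the well-founded relation `<_J`,
so `‖f‖_J = sup {‖g‖_J + 1 : g <_J f}`. -/
noncomputable def rankMod {I : Type u} (J : Set (Set I)) {o : Ordinal.{u}}
    [IsWellFounded (I → o.ToType) (LtMod J)] (f : I → o.ToType) : Ordinal.{u} :=
  IsWellFounded.rank (LtMod J) f

/-- `‖γ‖_J` for the nonstationary ideal `J` on `κ`: the Galvin-Hajnal rank of the function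
`κ → γ + 1` that is constant with value `γ`. -/
noncomputable def nonstationaryRank (κ : Cardinal.{u}) (hreg : κ.IsRegular) (hκ : ℵ₀ < κ)
    (γ : Ordinal.{u}) : Ordinal.{u} :=
  haveI := ltMod_nonstationary_isWellFounded hreg hκ (Order.succ γ)
  rankMod (nonstationaryIdeal κ)
    (fun _ : κ.ord.ToType => Ordinal.ToType.mk (o := Order.succ γ) ⟨γ, Order.lt_succ γ⟩)

/-! ### Classes of models omitting types, and the ordinal `δ₂` -/

/-- The order type of the relation `r` is an ordinal smaller than `o`. -/
def OtpLT {α : Type u} (r : α → α → Prop) (o : Ordinal.{u}) : Prop :=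
  ∃ _ : IsWellOrder α r, Ordinal.type r < o

/-- The order type of the relation `r` is an ordinal greater than or equal to `o`. -/
def OtpGE {α : Type u} (r : α → α → Prop) (o : Ordinal.{u}) : Prop :=
  ∃ _ : IsWellOrder α r, o ≤ Ordinal.type r

section Models

variable {L : FirstOrder.Language.{u, u}}

/-- The structure `M` omits the type `p` (a set of formulas in `n` variables, over the empty
set). -/
def Omits (M : Type u) [L.Structure M] {n : ℕ} (p : Set (L.Formula (Fin n))) : Prop :=
  ∀ v : Fin n → M, ∃ φ ∈ p, ¬ φ.Realize v

/-- `M ∈ EC(T, Γ)`: the (nonempty) model `M` of `T` omits every type in `Γ`. Types that are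
inconsistent with `T` are omitted by every model of `T`, so they need not be excluded. -/
def InEC {T : L.Theory} (Γ : Set (Σ n : ℕ, Set (L.Formula (Fin n))))
    (M : FirstOrder.Language.Theory.ModelType.{u, u, u} T) : Prop :=
  ∀ p ∈ Γ, Omits (L := L) M p.2

/-- The interpretation of the binary relation symbol `<`. -/
def ltRel (lt : L.Relations 2) (M : Type u) [L.Structure M] (a b : M) : Prop :=
  FirstOrder.Language.Structure.RelMap lt ![a, b]

/-- The interpretation `P^M` of the unary predicate `P`. -/
def predSet (P : L.Relations 1) (M : Type u) [L.Structure M] : Set M :=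
  {a | FirstOrder.Language.Structure.RelMap P ![a]}

/-- The order `<^M` restricted to the subset `s` of `M`. -/
def ltOn (lt : L.Relations 2) (M : Type u) [L.Structure M] (s : Set M) (a b : s) : Prop :=
  ltRel lt M a b

end Models

/-- The property of `δ` whose least instance is `δ₂(lam, γ, κ)`. The cardinality of a theory is, as
usual, that of its language (plus `ℵ₀`); `T` says that `<` is a linear order of the universe. -/
def DeltaTwoProp (lam : Cardinal.{u}) (γ : Ordinal.{u}) (κ : Cardinal.{u}) (δ : Ordinal.{u}) :
    Prop :=
  ∀ (L : FirstOrder.Language.{u, u}) (lt : L.Relations 2) (P : L.Relations 1) (T : L.Theory)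
    (Γ : Set (Σ n : ℕ, Set (L.Formula (Fin n)))),
    L.card ≤ lam → #Γ ≤ κ →
    (∀ M : FirstOrder.Language.Theory.ModelType.{u, u, u} T, IsStrictTotalOrder M (ltRel lt M)) →
    (∀ δ' < δ, ∃ M : FirstOrder.Language.Theory.ModelType.{u, u, u} T, InEC Γ M ∧
      OtpLT (ltOn lt M (predSet P M)) γ ∧ OtpGE (ltOn lt M (predSet P M)ᶜ) δ') →
    ∃ N : FirstOrder.Language.Theory.ModelType.{u, u, u} T, InEC Γ N ∧
      OtpLT (ltOn lt N (predSet P N)) (Order.succ κ).ord ∧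
      ¬ IsWellOrder ((predSet P N)ᶜ : Set N) (ltOn lt N (predSet P N)ᶜ)

/-- The ordinal `δ₂(lam, γ, κ)`. -/
noncomputable def deltaTwo₃ (lam : Cardinal.{u}) (γ : Ordinal.{u}) (κ : Cardinal.{u}) :
    Ordinal.{u} :=
  sInf {δ | DeltaTwoProp lam γ κ δ}

/-- The ordinal `δ₂(γ, κ) = δ₂(κ, γ, κ)`. -/
noncomputable def deltaTwo (γ : Ordinal.{u}) (κ : Cardinal.{u}) : Ordinal.{u} :=
  deltaTwo₃ κ γ κ

end GHBound

/-! Since `deltaTwo` is an infimum, two facts suffice: some ordinal has `DeltaTwoProp`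
(`exists_deltaTwoProp`), and no ordinal up to the rank has it (`not_deltaTwoProp`).

Failure: one theory of linear orders with at most `κ` omitted types attaches to every finite
sequence a function on `κ` with values in the model and a club, and demands that along a descending
sequence outside `P` the values descend in `P` at the limit points of the club. An infinite
descending sequence outside `P` involves countably many clubs; at a common limit point the values
would descend forever in `P`. So well-ordering of `P` forces well-ordering of its complement
(`isWellOrder_compl_of_inEC`). Yet the complement can have order type `δ` whenever `δ` is at most
the rank of the constant `β`: choose functions of decreasing rank along descending sequences of
ordinals, and clubs avoiding the nonstationary sets where the functions fail to decrease
(`exists_model`).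

Existence: attach to a descending sequence outside `P` the truth values of formulas at its Skolem
hull and an embedding of `P` into `γ`. These data form a tree whose size is bounded in terms of `κ`
and `γ`. If the tree is well founded, its rank bounds the order types of the complements; otherwise
a branch gives the required ill-founded model as a Skolem hull inside an ultraproduct
(`exists_model_of_branch`). -/

namespace GHBound

open FirstOrder FirstOrder.Language

/-! ### Existence of `δ₂`: the tree of approximations -/

section Existence

variable {L : FirstOrder.Language.{u, u}}

/-- Terms over `L` expanded by one layer of Skolem functions, in countably many variables. -/
abbrev SkTerm (L : FirstOrder.Language.{u, u}) : Type u :=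
  (L.sum L.skolem₁).Term ℕ

/-- The information on a tuple recorded in the tree of approximations: the `L`-formulas satisfied
by the values of Skolem terms, and ordinals attached to these values. -/
abbrev Info (L : FirstOrder.Language.{u, u}) (γ : Ordinal.{u}) : Type u :=
  Set (Σ k : ℕ, L.Formula (Fin k) × (Fin k → SkTerm L)) × (SkTerm L → γ.ToType)

/-- A model in `EC(T, Γ)` with an order preserving map of its predicate `P` into `γ` and a sequence
of elements. -/
structure Config (lt : L.Relations 2) (P : L.Relations 1) (T : L.Theory)
    (Γ : Set (Σ n : ℕ, Set (L.Formula (Fin n)))) (γ : Ordinal.{u}) where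
  /-- the model -/
  M : Theory.ModelType.{u, u, u} T
  inEC : InEC Γ M
  /-- the order preserving map -/
  e : M → γ.ToType
  e_lt : ∀ x ∈ predSet P M, ∀ y ∈ predSet P M, ltRel lt M x y → e x < e y
  /-- the sequence -/
  a : ℕ → M

/-- The sequence `a` cut off at `n`. -/
noncomputable def trunc {M : Type u} [Nonempty M] (a : ℕ → M) (n k : ℕ) : M :=
  if k < n then a k else Classical.arbitrary M

namespace Config

variable {lt : L.Relations 2} {P : L.Relations 1} {T : L.Theory}
  {Γ : Set (Σ n : ℕ, Set (L.Formula (Fin n)))} {γ : Ordinal.{u}}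

/-- The information on the first `n` elements of the sequence. -/
noncomputable def info (c : Config lt P T Γ γ) (n : ℕ) : Info L γ :=
  ({p | p.2.1.Realize fun i => (p.2.2 i).realize (trunc c.a n)},
    fun t => c.e (t.realize (trunc c.a n)))

/-- The node of the tree of approximations given by the first `n` elements of the sequence. -/
noncomputable def node (c : Config lt P T Γ γ) (n : ℕ) : ℕ × (ℕ → Info L γ) :=
  (n, fun m => c.info (min m n))

/-- The first `n` elements of the sequence form a descending sequence outside `P`. -/
def Desc (c : Config lt P T Γ γ) (n : ℕ) : Prop :=
  (∀ m < n, c.a m ∉ predSet P c.M) ∧ ∀ m, m + 1 < n → ltRel lt c.M (c.a (m + 1)) (c.a m)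

end Config

/-- One-step extension in the tree of approximations. -/
def Extends (lt : L.Relations 2) (P : L.Relations 1) (T : L.Theory)
    (Γ : Set (Σ n : ℕ, Set (L.Formula (Fin n)))) (γ : Ordinal.{u})
    (x y : ℕ × (ℕ → Info L γ)) : Prop :=
  ∃ (c : Config lt P T Γ γ) (n : ℕ), c.Desc (n + 1) ∧ x = c.node (n + 1) ∧ y = c.node n

/-- The values of a rank function form an initial segment of the ordinals, so a larger value would
inject the successor cardinal into `X`. -/
theorem rank_lt_ord_succ {X : Type u} (r : X → X → Prop) [IsWellFounded X r] (x : X) :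
    IsWellFounded.rank r x < (Order.succ #X).ord := by
  by_contra! h
  have key : ∀ o : (Order.succ #X).ord.ToType, ∃ y, IsWellFounded.rank r y = o.toOrd := fun o =>
    IsWellFounded.mem_range_rank_of_le ((Set.mem_Iio.1 o.toOrd.2).le.trans h)
  choose f hf using key
  have hinj : Function.Injective f := fun a b hab =>
    Ordinal.ToType.mk.symm.injective <| Subtype.ext <|
      (hf a).symm.trans ((congrArg _ hab).trans (hf b))
  have h1 := mk_le_of_injective hinj
  rw [mk_ord_toType] at h1
  exact (Order.lt_succ #X).not_ge h1

theorem trunc_congr {M : Type u} [Nonempty M] {a b : ℕ → M} {n : ℕ} (h : ∀ m < n, a m = b m) :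
    trunc a n = trunc b n := by
  funext k
  unfold trunc
  split_ifs with hk
  · exact h k hk
  · rfl

variable {lt : L.Relations 2} {P : L.Relations 1} {T : L.Theory}
  {Γ : Set (Σ n : ℕ, Set (L.Formula (Fin n)))} {γ : Ordinal.{u}}

theorem Config.node_congr (c : Config lt P T Γ γ) (b : ℕ → c.M) {n : ℕ}
    (h : ∀ m < n, c.a m = b m) : c.node n = ({c with a := b} : Config lt P T Γ γ).node n := by
  unfold Config.node Config.info
  have : ∀ m, trunc c.a (min m n) = trunc b (min m n) := fun m =>
    trunc_congr fun k hk => h k (hk.trans_le (min_le_right _ _))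
  simp [this]

theorem Config.type_le_rank [IsWellFounded _ (Extends lt P T Γ γ)] (c : Config lt P T Γ γ)
    [IsWellOrder ((predSet P c.M)ᶜ : Set c.M) (ltOn lt c.M (predSet P c.M)ᶜ)] :
    Ordinal.type (ltOn lt c.M (predSet P c.M)ᶜ) ≤
      IsWellFounded.rank (Extends lt P T Γ γ) (c.node 0) := by
  set r := ltOn lt c.M (predSet P c.M)ᶜ with hr
  -- Induction on the last element `x`, for all sequences at once: each `y` below `x` may be
  -- appended, which gives a child of the node.
  have key : ∀ x : ((predSet P c.M)ᶜ : Set c.M), ∀ (a : ℕ → c.M) (n : ℕ),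
      ({c with a := a} : Config lt P T Γ γ).Desc (n + 1) → a n = x →
      Ordinal.typein r x ≤ IsWellFounded.rank (Extends lt P T Γ γ)
        (({c with a := a} : Config lt P T Γ γ).node (n + 1)) := by
    intro x
    induction x using (IsWellFounded.wf (r := r)).induction with
    | _ x ih =>
    intro a n hd hx
    refine le_of_forall_lt fun o ho => ?_
    obtain ⟨y, rfl⟩ := Ordinal.typein_surj r (ho.trans (Ordinal.typein_lt_type r x))
    rw [Ordinal.typein_lt_typein] at ho
    have hag : ∀ m < n + 1, a m = Function.update a (n + 1) y m := fun m hm => by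
      rw [Function.update_of_ne hm.ne]
    have hd' : ({c with a := Function.update a (n + 1) y} : Config lt P T Γ γ).Desc
        (n + 1 + 1) := by
      refine ⟨fun m hm => ?_, fun m hm => ?_⟩
      · rcases Nat.lt_succ_iff_lt_or_eq.1 hm with h | rfl
        · simpa [← hag m h] using hd.1 m h
        · change Function.update a (n + 1) (y : c.M) (n + 1) ∈ (predSet P c.M)ᶜ
          rw [Function.update_self]
          exact y.2
      · rcases Nat.lt_succ_iff_lt_or_eq.1 hm with h | h
        · simpa [← hag m (by omega), ← hag (m + 1) h] using hd.2 m h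
        · obtain rfl : m = n := by omega
          simpa [← hag m (by omega), hx] using! ho
    refine (ih y ho (Function.update a (n + 1) y) (n + 1) hd' (by simp)).trans_lt ?_
    refine IsWellFounded.rank_lt_of_rel ⟨_, n + 1, hd', rfl, ?_⟩
    exact Config.node_congr ({c with a := a} : Config lt P T Γ γ) _ hag
  refine le_of_forall_lt fun o ho => ?_
  obtain ⟨y, rfl⟩ := Ordinal.typein_surj r ho
  have hd : ({c with a := fun _ => y} : Config lt P T Γ γ).Desc (0 + 1) :=
    ⟨fun m _ => y.2, fun m hm => by omega⟩
  refine (key y (fun _ => y) 0 hd rfl).trans_lt ?_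
  exact IsWellFounded.rank_lt_of_rel ⟨_, 0, hd, rfl, Config.node_congr c _ (by simp)⟩

theorem card_skTerm_le {κ : Cardinal.{u}} (hκ : ℵ₀ ≤ κ) (hL : L.card ≤ κ) : #(SkTerm L) ≤ κ := by
  refine Term.card_le.trans (max_le hκ ?_)
  rw [mk_sum]
  simp only [mk_nat, lift_aleph0, lift_uzero]
  exact add_le_of_le hκ (by simpa using hκ)
    (by simpa using card_functions_sum_skolem₁_le.trans (max_le hκ hL))

theorem card_info_le {κ : Cardinal.{u}} (hκ : ℵ₀ ≤ κ) (hL : L.card ≤ κ) :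
    #(ℕ × (ℕ → Info L γ)) ≤ ℵ₀ * (2 ^ κ * (γ.card + 1) ^ κ) ^ (ℵ₀ : Cardinal.{u}) := by
  have h1 := card_skTerm_le hκ hL
  have h0 : #(Σ k : ℕ, L.Formula (Fin k) × (Fin k → SkTerm L)) ≤ κ := by
    rw [mk_sigma]
    refine (sum_le_lift_mk_mul_iSup _).trans ?_
    refine mul_le_of_le hκ (by simpa using hκ) (ciSup_le' fun k => ?_)
    rw [mk_prod, lift_id, lift_id]
    refine mul_le_of_le hκ ?_ ?_
    · refine (mk_le_of_injective (f := fun φ : L.Formula (Fin k) =>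
        (⟨0, φ⟩ : Σ n, L.BoundedFormula (Fin k) n)) ?_).trans ?_
      · intro a b hab
        simpa using hab
      · refine BoundedFormula.card_le.trans (max_le hκ ?_)
        refine add_le_of_le hκ ?_ (by simpa using hL)
        simpa using (natCast_le_aleph0 (n := k)).trans hκ
    · rw [mk_arrow]
      simpa using (power_le_power_right h1).trans (power_nat_le hκ)
  have h2 : #(Info L γ) ≤ 2 ^ κ * (γ.card + 1) ^ κ := by
    rw [mk_prod, lift_id, lift_id, mk_set, mk_arrow, lift_id, lift_id, mk_toType]
    refine mul_le_mul' (power_le_power_left two_ne_zero h0) ?_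
    -- The summand 1 keeps the base nonzero, so that the exponent can be enlarged.
    exact (power_le_power_right le_self_add).trans (power_le_power_left (by simp) h1)
  rw [mk_prod, mk_arrow]
  simpa using mul_le_mul' le_rfl (power_le_power_right h2)

theorem realize_eq_trunc (t : SkTerm L) : ∀ᶠ n in Filter.atTop, ∀ (M : Type u) [Nonempty M]
    [L.Structure M] (a : ℕ → M), t.realize (trunc a n) = t.realize a := by
  induction t with
  | var i =>
    filter_upwards [Filter.eventually_gt_atTop i] with n hn M _ _ a
    simp [trunc, hn]
  | func f ts ih =>
    filter_upwards [Filter.eventually_all.2 ih] with n hn M _ _ a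
    simp only [Term.realize, hn]

/-- Successive steps may be witnessed by different models. They share only the recorded information,
and since a node keeps its whole history, that information is constant from each stage on. -/
theorem exists_branch (h : ¬ WellFounded (Extends lt P T Γ γ)) :
    ∃ (c : ℕ → Config lt P T Γ γ) (s : ℕ → Info L γ), (∀ k, (c k).Desc (k + 1)) ∧
      ∀ m, ∀ k ≥ m, (c k).info m = s m := by
  rw [wellFounded_iff_isEmpty_descending_chain, not_isEmpty_iff] at h
  obtain ⟨f, hf⟩ := h
  choose c n hd h1 h0 using hf
  have hn : ∀ k, k ≤ n k := by
    intro k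
    induction k with
    | zero => exact Nat.zero_le _
    | succ k ih =>
      have := congrArg Prod.fst ((h0 (k + 1)).symm.trans (h1 k))
      simp only [Config.node] at this
      omega
  have hi : ∀ k, ∀ m ≤ n k, (f k).2 m = (c k).info m := fun k m hm => by
    rw [h0 k]
    simp [Config.node, hm]
  have hs : ∀ k, ∀ m ≤ n k, (f (k + 1)).2 m = (c k).info m := fun k m hm => by
    rw [h1 k]
    simp [Config.node, hm.trans (Nat.le_succ _)]
  refine ⟨c, fun m => (f m).2 m, fun k => ?_, fun m k hk => ?_⟩
  · have := hn k
    exact ⟨fun m hm => (hd k).1 m (by omega), fun m hm => (hd k).2 m (by omega)⟩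
  · rw [← hi k m (hk.trans (hn k))]
    induction k, hk using Nat.le_induction with
    | base => rfl
    | succ k hk ih => rw [hs k m (hk.trans (hn k)), ← hi k m (hk.trans (hn k)), ih]

section Limit

variable (c : ℕ → Config lt P T Γ γ)

/-- The ultraproduct of the models along a branch. -/
abbrev limProd : Type u :=
  ((Filter.hyperfilter ℕ : Ultrafilter ℕ) : Filter ℕ).Product fun k => (c k).M

/-- The class of a sequence in the ultraproduct. -/
noncomputable def limMk (g : ∀ k, (c k).M) : limProd c :=
  (g : limProd c)

/-- The value of a Skolem term in the ultraproduct. -/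
noncomputable def limTerm (t : SkTerm L) : limProd c :=
  limMk c fun k => t.realize (c k).a

theorem limProd_models : limProd c ⊨ T :=
  Theory.model_iff _ |>.2 fun φ hφ => by
    rw [Ultraproduct.sentence_realize]
    exact Filter.Eventually.of_forall fun k => Theory.realize_sentence_of_mem T hφ

theorem realize_limTerm {n : ℕ} (φ : L.Formula (Fin n)) (ts : Fin n → SkTerm L) :
    (φ.Realize fun i => limTerm c (ts i)) ↔
      ∀ᶠ k in Filter.hyperfilter ℕ, φ.Realize fun i => (ts i).realize (c k).a :=
  Ultraproduct.realize_formula_cast φ fun i k => (ts i).realize (c k).a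

theorem relMap_limTerm {n : ℕ} (r : L.Relations n) (ts : Fin n → SkTerm L) :
    (Structure.RelMap r fun i => limTerm c (ts i)) ↔
      ∀ᶠ k in Filter.hyperfilter ℕ, Structure.RelMap r fun i => (ts i).realize (c k).a :=
  relMap_quotient_mk' _ r fun i k => (ts i).realize (c k).a

/-- The values of the Skolem terms form a substructure of the ultraproduct. -/
noncomputable def limSub : L.Substructure (limProd c) where
  carrier := Set.range (limTerm c)
  fun_mem {n} f x hx := by
    choose ts hts using hx
    obtain rfl : (fun i => limTerm c (ts i)) = x := funext hts
    exact ⟨Term.func (Sum.inl f) ts,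
      (Ultraproduct.funMap_cast f fun i k => (ts i).realize (c k).a).symm⟩

theorem realize_limMk {n : ℕ} (φ : L.BoundedFormula Empty n) (v : Fin n → ∀ k, (c k).M) :
    φ.Realize default (fun i => limMk c (v i)) ↔
      ∀ᶠ k in Filter.hyperfilter ℕ, φ.Realize default fun i => v i k := by
  refine Iff.trans (iff_of_eq (congrArg (φ.Realize · _) (Subsingleton.elim _ _)))
    ((Ultraproduct.boundedFormula_realize_cast φ (fun i : Empty => i.elim) v).trans
      (Filter.eventually_congr (Filter.Eventually.of_forall fun k => ?_)))
  exact iff_of_eq (congrArg (φ.Realize · _) (Subsingleton.elim _ _))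

/-- Tarski–Vaught test: a witness in the ultraproduct gives witnesses in almost all factors, where
the Skolem function of `φ` then also picks one. Only `L`-formulas are tested, so one layer of Skolem
functions is enough. -/
theorem limSub_isElementary : (limSub c).IsElementary := by
  refine (limSub c).isElementary_of_exists fun n φ x a h => ?_
  choose ts hts using fun i => (x i).2
  refine ⟨⟨_, Term.func (Sum.inr φ) ts, rfl⟩, ?_⟩
  obtain ⟨g, rfl⟩ : ∃ g, limMk c g = a := Quotient.exists_rep a
  have key : ∀ g : ∀ k, (c k).M,
      φ.Realize default (Fin.snoc (Subtype.val ∘ x) (limMk c g) : Fin (n + 1) → limProd c) ↔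
        ∀ᶠ k in Filter.hyperfilter ℕ, φ.Realize default
          (Fin.snoc (fun i => (ts i).realize (c k).a) (g k) : Fin (n + 1) → (c k).M) := by
    intro g
    convert realize_limMk c φ (Fin.snoc (fun i k => (ts i).realize (c k).a) g) using 3 with k
    · refine Fin.lastCases ?_ (fun i => ?_) k
      · simp
      · simp [← hts i, limTerm]
    · refine iff_of_eq (congrArg _ (funext fun i => ?_))
      refine Fin.lastCases ?_ (fun i => ?_) i <;> simp
  refine (key _).2 (((key g).1 h).mono fun k hk => ?_)
  exact Classical.epsilon_spec (p := fun b => φ.Realize default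
    (Fin.snoc (fun i => (ts i).realize (c k).a) b : Fin (n + 1) → (c k).M)) ⟨g k, hk⟩

theorem exists_model_of_branch {κ : Cardinal.{u}} (hκ : ℵ₀ ≤ κ) (hL : L.card ≤ κ)
    (hT : ∀ M : Theory.ModelType.{u, u, u} T, IsStrictTotalOrder M (ltRel lt M))
    (s : ℕ → Info L γ) (hd : ∀ k, (c k).Desc (k + 1))
    (hs : ∀ m, ∀ k ≥ m, (c k).info m = s m) :
    ∃ N : Theory.ModelType.{u, u, u} T, InEC Γ N ∧
      OtpLT (ltOn lt N (predSet P N)) (Order.succ κ).ord ∧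
      ¬ IsWellOrder ((predSet P N)ᶜ : Set N) (ltOn lt N (predSet P N)ᶜ) := by
  have hU : ∀ {p : ℕ → Prop}, (∃ m, ∀ k ≥ m, p k) → ∀ᶠ k in Filter.hyperfilter ℕ, p k :=
    fun h => Nat.hyperfilter_le_atTop (Filter.eventually_atTop.2 h)
  let S : L.ElementarySubstructure (limProd c) := ⟨limSub c, limSub_isElementary c⟩
  have : limProd c ⊨ T := limProd_models c
  let N : Theory.ModelType.{u, u, u} T := Theory.ModelType.of T S
  let el : SkTerm L → N := fun t => ⟨limTerm c t, t, rfl⟩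
  have hel : Function.Surjective el := fun y => by
    obtain ⟨t, ht⟩ := y.2
    exact ⟨t, Subtype.ext ht⟩
  have hform : ∀ {n : ℕ} (φ : L.Formula (Fin n)) (ts : Fin n → SkTerm L),
      (φ.Realize fun i => el (ts i)) ↔
        ∀ᶠ k in Filter.hyperfilter ℕ, φ.Realize fun i => (ts i).realize (c k).a :=
    fun φ ts => (S.subtype.map_formula φ fun i => el (ts i)).symm.trans (realize_limTerm c φ ts)
  have hrel : ∀ {n : ℕ} (r : L.Relations n) (ts : Fin n → SkTerm L),
      (Structure.RelMap r fun i => el (ts i)) ↔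
        ∀ᶠ k in Filter.hyperfilter ℕ, Structure.RelMap r fun i => (ts i).realize (c k).a :=
    fun r ts => (S.subtype.map_rel r fun i => el (ts i)).symm.trans (relMap_limTerm c r ts)
  have hlt : ∀ t t', ltRel lt N (el t) (el t') ↔ ∀ᶠ k in Filter.hyperfilter ℕ,
      ltRel lt (c k).M (t.realize (c k).a) (t'.realize (c k).a) := by
    intro t t'
    refine Iff.trans (iff_of_eq (congrArg (Structure.RelMap lt) (funext fun i => ?_))) ((hrel lt ![t, t']).trans
      (Filter.eventually_congr (Filter.Eventually.of_forall fun k =>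
        iff_of_eq (congrArg _ (funext fun i => ?_))))) <;> fin_cases i <;> rfl
  have hP : ∀ t, el t ∈ predSet P N ↔ ∀ᶠ k in Filter.hyperfilter ℕ,
      t.realize (c k).a ∈ predSet P (c k).M := by
    intro t
    change Structure.RelMap P ![el t] ↔ _
    refine Iff.trans (iff_of_eq (congrArg (Structure.RelMap P) (funext fun i => ?_))) ((hrel P ![t]).trans
      (Filter.eventually_congr (Filter.Eventually.of_forall fun k =>
        iff_of_eq (congrArg _ (funext fun i => ?_))))) <;> fin_cases i <;> rfl
  have htot := hT N
  refine ⟨N, fun p hp v => ?_, ?_, ?_⟩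
  · choose ts hts using fun i => hel (v i)
    obtain rfl : (fun i => el (ts i)) = v := funext hts
    obtain ⟨m, hm⟩ := (Filter.eventually_all.2 fun i => realize_eq_trunc (ts i)).exists
    have hm' : ∀ (φ : L.Formula (Fin p.1)), ∀ k ≥ m,
        ((φ.Realize fun i => (ts i).realize (c k).a) ↔ ⟨p.1, φ, ts⟩ ∈ (s m).1) := by
      intro φ k hk
      rw [← hs m k hk]
      simp only [Config.info, Set.mem_ofPred_eq, hm]
    -- A formula of `p` failing in the `m`-th model fails in all later ones, as they share the
    -- information of stage `m`.
    obtain ⟨φ, hφ, hn⟩ := (c m).inEC p hp fun i => (ts i).realize (c m).a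
    refine ⟨φ, hφ, fun h => hn ?_⟩
    obtain ⟨k, hk, hk'⟩ := (((hform φ ts).1 h).and (hU ⟨m, fun k hk => hk⟩)).exists
    exact (hm' φ m le_rfl).2 ((hm' φ k hk').1 hk)
  · choose τ hτ using hel
    choose m hm using fun t : SkTerm L => (realize_eq_trunc t).exists
    have hE : ∀ t, ∀ k ≥ m t, (c k).e (t.realize (c k).a) = (s (m t)).2 t := by
      intro t k hk
      rw [← hs (m t) k hk]
      simp only [Config.info, hm]
    -- The stabilized ordinals embed `P` of the limit into `γ`, so it is well ordered. Its length is
    -- below `κ⁺` because there are at most `κ` Skolem terms.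
    have hmono : ∀ x y : predSet P N, ltOn lt N (predSet P N) x y →
        (s (m (τ x))).2 (τ x) < (s (m (τ y))).2 (τ y) := by
      intro x y hxy
      have h1 : ltRel lt N (el (τ x)) (el (τ y)) := by rwa [hτ, hτ]
      have h2 : el (τ x) ∈ predSet P N := by rw [hτ]; exact x.2
      have h3 : el (τ y) ∈ predSet P N := by rw [hτ]; exact y.2
      obtain ⟨k, hk⟩ := (((hlt _ _).1 h1).and (((hP _).1 h2).and (((hP _).1 h3).and
        ((hU ⟨m (τ x), fun k hk => hk⟩).and (hU ⟨m (τ y), fun k hk => hk⟩))))).exists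
      rw [← hE _ k hk.2.2.2.1, ← hE _ k hk.2.2.2.2]
      exact (c k).e_lt _ hk.2.1 _ hk.2.2.1 hk.1
    have hwo : IsWellOrder (predSet P N) (ltOn lt N (predSet P N)) :=
      { wf := Subrelation.wf (hmono _ _)
          (InvImage.wf (fun x : predSet P N => (s (m (τ x))).2 (τ x)) wellFounded_lt)
        trichotomous := fun x y h1 h2 => Subtype.ext (htot.trichotomous x y h1 h2) }
    refine ⟨hwo, ?_⟩
    rw [lt_ord, Ordinal.card_type, Order.lt_succ_iff]
    refine (mk_subtype_le _).trans (le_trans ?_ (card_skTerm_le hκ hL))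
    exact mk_le_of_injective (f := τ) (Function.LeftInverse.injective hτ)
  · intro hwo
    have hmem : ∀ n, el (Term.var n) ∈ (predSet P N)ᶜ := fun n hn => by
      obtain ⟨k, hk, hk'⟩ := (((hP _).1 hn).and (hU ⟨n, fun k hk => hk⟩)).exists
      exact (hd k).1 n (Nat.lt_succ_of_le hk') hk
    refine (wellFounded_iff_isEmpty_descending_chain.1 hwo.wf).false
      ⟨fun n => ⟨el (Term.var n), hmem n⟩, fun n => (hlt _ _).2 (hU ⟨n + 1, fun k hk => ?_⟩)⟩
    exact (hd k).2 n (Nat.lt_succ_of_le hk)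

end Limit

theorem exists_deltaTwoProp {κ : Cardinal.{u}} (hκ : ℵ₀ ≤ κ) (γ : Ordinal.{u}) :
    ∃ δ, DeltaTwoProp κ γ κ δ := by
  -- The outer successor makes the successor cardinal itself an admissible `δ'`; by
  -- `rank_lt_ord_succ` it exceeds every rank in the tree.
  refine ⟨Order.succ
    (Order.succ (ℵ₀ * (2 ^ κ * (γ.card + 1) ^ κ) ^ (ℵ₀ : Cardinal.{u}))).ord, ?_⟩
  intro L lt P T Γ hL _ hT hM
  by_cases hwf : WellFounded (Extends lt P T Γ γ)
  · exfalso
    obtain ⟨M, hEC, ⟨hP, hPlt⟩, hQ, hQle⟩ := hM _ (Order.lt_succ _)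
    classical
    rw [← Ordinal.type_toType γ, Ordinal.type_lt_iff] at hPlt
    obtain ⟨g⟩ := hPlt
    have hne : Nonempty γ.ToType := ⟨g.top⟩
    let c : Config lt P T Γ γ :=
      { M := M
        inEC := hEC
        e := fun x => if h : x ∈ predSet P M then g ⟨x, h⟩ else Classical.arbitrary _
        e_lt := fun x hx y hy hxy => by
          simpa [hx, hy] using g.map_rel_iff.2
            (show ltOn lt M (predSet P M) ⟨x, hx⟩ ⟨y, hy⟩ from hxy)
        a := fun _ => Classical.arbitrary _ }
    have hwf' : IsWellFounded _ (Extends lt P T Γ γ) := ⟨hwf⟩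
    have h1 := (hQle.trans c.type_le_rank).trans_lt (rank_lt_ord_succ _ _)
    rw [ord_lt_ord, Order.succ_lt_succ_iff] at h1
    exact (card_info_le hκ hL).not_gt h1
  · obtain ⟨c, s, hd, hs⟩ := exists_branch hwf
    exact exists_model_of_branch c hκ hL hT s hd hs

end Existence
-- The language, the theory and the omitted types
section Language

/-- The relation symbols: `<`, `P` and, in every arity, `meets j i` for indices `j`, `i`. -/
inductive GHRel (I : Type u) : ℕ → Type u
  | lt : GHRel I 2
  | pred : GHRel I 1
  | meets (n : ℕ) (j i : I) : GHRel I n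

/-- The language describing descending sequences of functions modulo a club filter. A function
symbol `i` applied to `v` is the value at `i` of the function attached to `v`; the symbol
`meets j i` says that the club attached to `v` meets the interval `(j, i)`. -/
def ghLang (I : Type u) : FirstOrder.Language.{u, u} :=
  ⟨fun _ => I, GHRel I⟩

variable {I : Type u}

/-- The symbol `<`. -/
abbrev ltSym (I : Type u) : (ghLang I).Relations 2 := GHRel.lt

/-- The symbol `P`. -/
abbrev predSym (I : Type u) : (ghLang I).Relations 1 := GHRel.pred

/-- The symbol for a function at the index `i`. -/
abbrev valSym (n : ℕ) (i : I) : (ghLang I).Functions n := i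

/-- The symbol for a club meeting an interval. -/
abbrev meetsSym (n : ℕ) (j i : I) : (ghLang I).Relations n := GHRel.meets n j i

theorem ghLang_card_le {κ : Cardinal.{u}} (hκ : ℵ₀ ≤ κ) (hI : #I ≤ κ) :
    (ghLang I).card ≤ κ := by
  have h1 : #(ℕ × I × I) ≤ κ := by
    simp only [mk_prod, lift_uzero, lift_id, mk_nat, lift_aleph0]
    exact mul_le_of_le hκ hκ (mul_le_of_le hκ hI hI)
  have h2 : #(Σ _ : ℕ, I) ≤ κ := by
    simp only [mk_sigma, sum_const, mk_nat, lift_uzero, lift_aleph0]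
    exact mul_le_of_le hκ hκ hI
  have h3 : #(Σ n, GHRel I n) ≤ κ := by
    let f : Option (Option (ℕ × I × I)) → Σ n, GHRel I n := fun x => match x with
      | none => ⟨2, .lt⟩
      | some none => ⟨1, .pred⟩
      | some (some (n, j, i)) => ⟨n, .meets n j i⟩
    have hf : Function.Surjective f := by
      rintro ⟨n, r⟩
      cases r with
      | lt => exact ⟨none, rfl⟩
      | pred => exact ⟨some none, rfl⟩
      | meets n j i => exact ⟨some (some (n, j, i)), rfl⟩
    refine (mk_le_of_surjective hf).trans ?_
    simp only [mk_option]
    exact add_le_of_le hκ (add_le_of_le hκ h1 (one_le_aleph0.trans hκ)) (one_le_aleph0.trans hκ)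
  rw [FirstOrder.Language.card, Symbols, mk_sum, lift_id, lift_id]
  exact add_le_of_le hκ h2 h3

/-- `s < t`. -/
abbrev ltF {α : Type} (s t : (ghLang I).Term α) : (ghLang I).Formula α := (ltSym I).formula₂ s t

/-- `P t`. -/
abbrev predF {α : Type} (t : (ghLang I).Term α) : (ghLang I).Formula α := (predSym I).formula₁ t

/-- The club attached to all the variables meets `(j, i)`. -/
abbrev meetsF (n : ℕ) (j i : I) : (ghLang I).Formula (Fin n) :=
  (meetsSym n j i).formula Term.var

/-- The value at `i` attached to all the variables. -/
abbrev valT (n : ℕ) (i : I) : (ghLang I).Term (Fin n) := Term.func (valSym n i) Term.var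

/-- The value at `i` attached to all the variables but the last. -/
abbrev valInitT (n : ℕ) (i : I) : (ghLang I).Term (Fin (n + 1)) :=
  Term.func (valSym n i) fun m => Term.var m.castSucc

/-- The theory of strict linear orders. -/
def ghTheory (I : Type u) : (ghLang I).Theory :=
  {(ltSym I).irreflexive, (ltSym I).transitive,
    ∀' ∀' ((ltSym I).boundedFormula₂ (&0) (&1) ⊔ ((&0 =' &1) ⊔ (ltSym I).boundedFormula₂ (&1) (&0)))}

theorem models_ghTheory_iff {M : Type u} [(ghLang I).Structure M] :
    M ⊨ ghTheory I ↔ IsStrictTotalOrder M (ltRel (ltSym I) M) := by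
  have h : (M ⊨ (∀' ∀' ((ltSym I).boundedFormula₂ (&0) (&1) ⊔
      ((&0 =' &1) ⊔ (ltSym I).boundedFormula₂ (&1) (&0))) : (ghLang I).Sentence)) ↔
      ∀ x y : M, ltRel (ltSym I) M x y ∨ x = y ∨ ltRel (ltSym I) M y x := by
    simp [Sentence.Realize, Formula.Realize, BoundedFormula.realize_rel₂, ltRel, Fin.snoc]
  rw [Theory.model_iff]
  simp only [ghTheory, Set.mem_insert_iff, Set.mem_singleton_iff, forall_eq_or_imp, forall_eq, h,
    Relations.realize_irreflexive, Relations.realize_transitive]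
  constructor
  · rintro ⟨h1, h2, h3⟩
    exact { irrefl := h1.irrefl, trans := h2.trans,
            trichotomous := fun x y hx hy => ((h3 x y).resolve_left hx).resolve_right hy }
  · intro h
    refine ⟨⟨h.irrefl⟩, ⟨h.trans⟩, fun x y => ?_⟩
    by_contra! h'
    exact h'.2.1 (h.trichotomous x y h'.1 h'.2.2)

/-- The type whose omission says that the club attached to the variables is unbounded. -/
def unboundedType (n : ℕ) (j : I) : Set ((ghLang I).Formula (Fin n)) :=
  Set.range fun k => ∼(meetsF n j k)

/-- The type whose omission says that `meets j` is monotone. -/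
def monoType (n : ℕ) (j k k' : I) : Set ((ghLang I).Formula (Fin n)) :=
  {meetsF n j k, ∼(meetsF n j k')}

/-- The type whose omission says that the function attached to a descending sequence is, at limit
points of the club, smaller than the function attached to the sequence without its last element. -/
def descentType [LT I] (n : ℕ) (i : I) : Set ((ghLang I).Formula (Fin (n + 2))) :=
  Set.range (fun m : Fin (n + 1) => ltF (Term.var m.succ) (Term.var m.castSucc)) ∪
    Set.range (fun m => ∼(predF (Term.var m))) ∪ (fun j => meetsF (n + 2) j i) '' {j | j < i} ∪
    {∼(predF (valT (n + 2) i) ⊓ ltF (valT (n + 2) i) (valInitT (n + 1) i))}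

/-- The types to be omitted. -/
def ghTypes (I : Type u) [LT I] : Set (Σ n : ℕ, Set ((ghLang I).Formula (Fin n))) :=
  {p | (∃ n j, p = ⟨n, unboundedType n j⟩) ∨ (∃ n j k k', k < k' ∧ p = ⟨n, monoType n j k k'⟩) ∨
    ∃ n i, (∃ j, j < i) ∧ p = ⟨n + 2, descentType n i⟩}

theorem card_ghTypes_le [LT I] {κ : Cardinal.{u}} (hκ : ℵ₀ ≤ κ) (hI : #I ≤ κ) :
    #(ghTypes I) ≤ κ := by
  let f : ((ℕ × I) ⊕ (ℕ × I × I × I)) ⊕ (ℕ × I) → Σ n : ℕ, Set ((ghLang I).Formula (Fin n)) :=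
    Sum.elim (Sum.elim (fun x => ⟨x.1, unboundedType x.1 x.2⟩)
      fun x => ⟨x.1, monoType x.1 x.2.1 x.2.2.1 x.2.2.2⟩) fun x => ⟨_, descentType x.1 x.2⟩
  have hf : ghTypes I ⊆ Set.range f := by
    rintro p (⟨n, j, rfl⟩ | ⟨n, j, k, k', -, rfl⟩ | ⟨n, i, -, rfl⟩)
    · exact ⟨.inl (.inl (n, j)), rfl⟩
    · exact ⟨.inl (.inr (n, j, k, k')), rfl⟩
    · exact ⟨.inr (n, i), rfl⟩
  refine (mk_le_mk_of_subset hf).trans (mk_range_le.trans ?_)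
  simp only [mk_sum, mk_prod, lift_uzero, lift_id, mk_nat, lift_aleph0]
  have h : ℵ₀ * #I ≤ κ := mul_le_of_le hκ hκ hI
  exact add_le_of_le hκ (add_le_of_le hκ h
    (mul_le_of_le hκ hκ (mul_le_of_le hκ hI (mul_le_of_le hκ hI hI)))) h

section Realize

variable {M : Type u} [(ghLang I).Structure M]

theorem realize_meetsF {n : ℕ} {j i : I} {v : Fin n → M} :
    (meetsF n j i).Realize v ↔ Structure.RelMap (meetsSym n j i) v :=
  Formula.realize_rel

theorem omits_unboundedType {n : ℕ} {j : I} : Omits M (unboundedType n j) ↔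
    ∀ v : Fin n → M, ∃ k, Structure.RelMap (meetsSym n j k) v := by
  simp [Omits, unboundedType, Formula.realize_not]

theorem omits_monoType {n : ℕ} {j k k' : I} : Omits M (monoType n j k k') ↔
    ∀ v : Fin n → M, Structure.RelMap (meetsSym n j k) v →
      Structure.RelMap (meetsSym n j k') v := by
  refine forall_congr' fun v => ?_
  simp only [monoType, Set.mem_insert_iff, Set.mem_singleton_iff, exists_eq_or_imp,
    exists_eq_left, realize_meetsF, Formula.realize_not, not_not]
  tauto

theorem omits_descentType [LT I] {n : ℕ} {i : I} : Omits M (descentType n i) ↔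
    ∀ v : Fin (n + 2) → M, (∀ m : Fin (n + 1), ltRel (ltSym I) M (v m.succ) (v m.castSucc)) →
      (∀ m, v m ∉ predSet (predSym I) M) →
      (∀ j < i, Structure.RelMap (meetsSym (n + 2) j i) v) →
      Structure.funMap (valSym (n + 2) i) v ∈ predSet (predSym I) M ∧
        ltRel (ltSym I) M (Structure.funMap (valSym (n + 2) i) v)
          (Structure.funMap (valSym (n + 1) i) (Fin.init v)) := by
  refine forall_congr' fun v => ?_
  rw [← not_iff_not]
  simp only [descentType, not_exists, not_and, not_not, Set.mem_union, Set.mem_singleton_iff,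
    or_imp, forall_and, Set.forall_mem_range, Set.forall_mem_image, forall_eq,
    realize_meetsF, Formula.realize_not, Formula.realize_inf, Formula.realize_rel₂,
    Formula.realize_rel₁, Term.realize_func, Term.realize_var, Set.mem_ofPred_eq, predSet, ltRel,
    not_forall, exists_prop]
  have : (fun m : Fin (n + 1) => v m.castSucc) = Fin.init v := rfl
  simp only [this]
  tauto

end Realize

end Language
-- Well-ordering of `P` passes to its complement
section NoIllFoundedModel

variable {κ : Cardinal.{u}}

theorem exists_forall_lt_of_mk_lt (hreg : κ.IsRegular) {s : Set κ.ord.ToType} (hs : #s < κ) :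
    ∃ x, ∀ y ∈ s, y < x := by
  refine not_isCofinal_iff.1 fun h => (Order.cof_le h).not_gt ?_
  rwa [Ordinal.cof_toType, hreg.cof_ord]

/-- By regularity one function `h` strictly dominates all the `f n` on initial segments; the least
strict upper bound of its iterates at a point is closed under every `f n`. -/
theorem exists_closure_point (hreg : κ.IsRegular) (hκ : ℵ₀ < κ)
    (f : ℕ → κ.ord.ToType → κ.ord.ToType) :
    ∃ i, (∃ j, j < i) ∧ ∀ n, ∀ j < i, f n j < i := by
  have : NoMaxOrder κ.ord.ToType := Cardinal.noMaxOrder hκ.le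
  have h1 : ∀ j, ∃ x, ∀ n, ∀ j' ≤ j, f n j' < x := by
    intro j
    obtain ⟨j₁, hj₁⟩ := exists_gt j
    have hc : #(Set.range fun p : ℕ × Set.Iio j₁ => f p.1 p.2) < κ := by
      refine mk_range_le.trans_lt ?_
      simp only [mk_prod, mk_nat, lift_aleph0, lift_uzero]
      exact mul_lt_of_lt hκ.le hκ ((mk_Iio_lt j₁ (by simp)).trans_eq (mk_ord_toType κ))
    obtain ⟨x, hx⟩ := exists_forall_lt_of_mk_lt hreg hc
    exact ⟨x, fun n j' hj' => hx _ ⟨(n, ⟨j', hj'.trans_lt hj₁⟩), rfl⟩⟩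
  choose h hh using h1
  have hne : Nonempty κ.ord.ToType := by
    rw [Ordinal.nonempty_toType_iff, Ne, Cardinal.ord_eq_zero]
    exact (aleph0_pos.trans hκ).ne'
  let j₀ : κ.ord.ToType := Classical.arbitrary _
  have hc : #(Set.range fun n => h^[n] j₀) < κ := by
    refine lt_of_le_of_lt ?_ hκ
    simpa using mk_range_le_lift (f := fun n => h^[n] j₀)
  obtain ⟨x, hx⟩ := exists_forall_lt_of_mk_lt hreg hc
  let S : Set κ.ord.ToType := {x | ∀ n, h^[n] j₀ < x}
  have hS : S.Nonempty := ⟨x, fun n => hx _ ⟨n, rfl⟩⟩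
  have hmem := WellFounded.min_mem wellFounded_lt S hS
  refine ⟨WellFounded.min wellFounded_lt S hS, ⟨j₀, hmem 0⟩, fun n j hj => ?_⟩
  obtain ⟨m, hm⟩ : ∃ m, j ≤ h^[m] j₀ := by
    by_contra! hcon
    exact WellFounded.not_lt_min wellFounded_lt S hcon hj
  refine (hh _ n j hm).trans ?_
  rw [← Function.iterate_succ_apply' h]
  exact hmem (m + 1)

theorem isWellOrder_compl_of_inEC (hreg : κ.IsRegular) (hκ : ℵ₀ < κ)
    (N : Theory.ModelType.{u, u, u} (ghTheory κ.ord.ToType)) (hN : InEC (ghTypes κ.ord.ToType) N)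
    (hP : IsWellOrder (predSet (predSym κ.ord.ToType) N) (ltOn (ltSym κ.ord.ToType) N (predSet (predSym κ.ord.ToType) N))) :
    IsWellOrder ((predSet (predSym κ.ord.ToType) N)ᶜ : Set N)
      (ltOn (ltSym κ.ord.ToType) N (predSet (predSym κ.ord.ToType) N)ᶜ) := by
  have htot : IsStrictTotalOrder N (ltRel (ltSym κ.ord.ToType) N) :=
    models_ghTheory_iff.1 N.is_model
  have hwf : WellFounded (ltOn (ltSym κ.ord.ToType) N (predSet (predSym κ.ord.ToType) N)ᶜ) := by
    rw [wellFounded_iff_isEmpty_descending_chain]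
    refine ⟨fun ⟨x, hx⟩ => ?_⟩
    let v : ∀ n, Fin n → N := fun n m => x m
    have hub := fun n j => omits_unboundedType.1 (hN _ (Or.inl ⟨n + 2, j, rfl⟩)) (v (n + 2))
    choose f hf using hub
    -- The index `i` acts as a limit point of the clubs of all the finite initial segments
    -- simultaneously.
    obtain ⟨i, hi, hcl⟩ := exists_closure_point hreg hκ f
    have hE : ∀ n, ∀ j < i, Structure.RelMap (meetsSym (n + 2) j i) (v (n + 2)) := fun n j hj =>
      omits_monoType.1 (hN _ (Or.inr (Or.inl ⟨n + 2, j, f n j, i, hcl n j hj, rfl⟩))) _ (hf n j)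
    have hd := fun n => omits_descentType.1 (hN _ (Or.inr (Or.inr ⟨n, i, hi, rfl⟩))) (v (n + 2))
      (fun m => hx m) (fun m => (x m).2) (hE n)
    exact (wellFounded_iff_isEmpty_descending_chain.1 hP.wf).false
      ⟨fun n => ⟨_, (hd n).1⟩, fun n => (hd (n + 1)).2⟩
  exact { wf := hwf
          trichotomous := fun x y h1 h2 => Subtype.ext (htot.trichotomous x y h1 h2) }

end NoIllFoundedModel

/-! ### Ordered sums as structures -/

section Structure

variable {I A B : Type u} [LT A] [LT B]

/-- The structure on the ordered sum of `A` and `B` in which `P` is interpreted as `A`. -/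
@[reducible] def ghStructure (val : ∀ n, I → (Fin n → A ⊕ B) → A)
    (meets : ∀ n, I → I → (Fin n → A ⊕ B) → Prop) : (ghLang I).Structure (A ⊕ B) where
  funMap {n} i v := Sum.inl (val n i v)
  RelMap {n} r := match n, r with
    | _, GHRel.lt => fun v => Sum.Lex (· < ·) (· < ·) (v 0) (v 1)
    | _, GHRel.pred => fun v => (v 0).isLeft
    | _, GHRel.meets n j i => fun v => meets n j i v

end Structure

/-! ### Trees of functions of decreasing rank -/

section Tree

variable {I M : Type u} {o : Ordinal.{u}} {J : Set (Set I)}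

theorem exists_le_rankMod [IsWellFounded (I → o.ToType) (LtMod J)] {g : I → o.ToType}
    {a : Ordinal.{u}} (h : a < rankMod J g) : ∃ g', LtMod J g' g ∧ a ≤ rankMod J g' := by
  rw [rankMod, IsWellFounded.rank_eq, Ordinal.lt_iSup_iff] at h
  obtain ⟨⟨g', hg'⟩, h⟩ := h
  exact ⟨g', hg', Order.lt_succ_iff.1 h⟩

variable (J) [IsWellFounded (I → o.ToType) (LtMod J)]

open Classical in
/-- A function below `g` of rank at least `a`, if there is one. -/
noncomputable def below (g : I → o.ToType) (a : Ordinal.{u}) : I → o.ToType :=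
  if h : ∃ g', LtMod J g' g ∧ a ≤ rankMod J g' then h.choose else g

variable (β : o.ToType) (level : M → Ordinal.{u})

/-- Functions below `β` attached to finite sequences; to a sequence with decreasing levels is
attached a function below the one attached to the initial segment. -/
noncomputable def tree : ∀ n, (Fin n → M) → I → o.ToType
  | 0, _ => fun _ => β
  | n + 1, v => below J (tree n (Fin.init v)) (level (v (Fin.last n)))

/-- The indices at which some function attached to an initial segment fails to be smaller than its
predecessor. -/
def bad : ∀ n, (Fin n → M) → Set I
  | 0, _ => ∅
  | n + 1, v => {i | ¬ tree J β level (n + 1) v i < tree J β level n (Fin.init v) i} ∪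
      bad n (Fin.init v)

variable {J β level}

theorem tree_le_of_notMem_bad {n : ℕ} {v : Fin n → M} {i : I} (hi : i ∉ bad J β level n v) :
    tree J β level n v i ≤ β := by
  induction n with
  | zero => exact le_rfl
  | succ n ih =>
    simp only [bad, Set.mem_union, Set.mem_ofPred_eq, not_or, not_not] at hi
    exact hi.1.le.trans (ih hi.2)

theorem tree_lt_of_notMem_bad {n : ℕ} {v : Fin (n + 1) → M} {i : I}
    (hi : i ∉ bad J β level (n + 1) v) :
    i ∉ bad J β level n (Fin.init v) ∧
      tree J β level (n + 1) v i < tree J β level n (Fin.init v) i := by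
  simp only [bad, Set.mem_union, Set.mem_ofPred_eq, not_or, not_not] at hi
  exact hi.symm

/-- The second conjunct is the induction invariant: the rank still exceeds any level that may come
next, so `below` finds a genuine function. Its form also covers the empty sequence. -/
theorem bad_mem (hJ : ∅ ∈ J) (hJ' : ∀ s ∈ J, ∀ t ∈ J, s ∪ t ∈ J) {δ : Ordinal.{u}}
    (hδ : δ ≤ rankMod J fun _ => β) {n : ℕ} {v : Fin n → M} (hv : StrictAnti (level ∘ v))
    (hvδ : ∀ m, level (v m) < δ) :
    bad J β level n v ∈ J ∧
      ∀ a < δ, (∀ m, a < level (v m)) → a < rankMod J (tree J β level n v) := by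
  induction n with
  | zero => exact ⟨hJ, fun a ha _ => ha.trans_le hδ⟩
  | succ n ih =>
    obtain ⟨h1, h2⟩ := ih (v := Fin.init v) (fun a b hab => hv (Fin.castSucc_lt_castSucc_iff.2 hab))
      fun m => hvδ m.castSucc
    have h3 := exists_le_rankMod (h2 (level (v (Fin.last n))) (hvδ _)
      fun m => hv (Fin.castSucc_lt_last m))
    have h4 : tree J β level (n + 1) v = h3.choose := by
      rw [tree, below, dif_pos h3]
    refine ⟨hJ' _ ?_ _ h1, fun a _ ha => (ha (Fin.last n)).trans_le ?_⟩
    · rw [h4]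
      exact h3.choose_spec.1
    · rw [h4]
      exact h3.choose_spec.2

end Tree

/-! ### Models with long complements, and the lower bound for `δ₂` -/

section Model

variable {κ : Cardinal.{u}}

open Classical in
/-- A club disjoint from `s`, if there is one. -/
noncomputable def clubOff {α : Type u} [LinearOrder α] (s : Set α) : Set α :=
  if h : ∃ C, IsClub C ∧ Disjoint s C then h.choose else Set.univ

theorem isClub_clubOff {α : Type u} [LinearOrder α] (s : Set α) : IsClub (clubOff s) := by
  unfold clubOff
  split_ifs with h
  · exact h.choose_spec.1
  · exact IsClub.univ

theorem disjoint_clubOff {α : Type u} [LinearOrder α] {s : Set α} (h : ¬ IsStationary s) :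
    Disjoint s (clubOff s) := by
  rw [not_isStationary_iff] at h
  rw [clubOff, dif_pos h]
  exact h.choose_spec.2

/-- For the least index the hypothesis `h` is vacuous; `hi` excludes it, as does `ghTypes`. -/
theorem mem_of_isClub_of_forall_lt {α : Type u} [LinearOrder α] {C : Set α} (hC : IsClub C) {i : α}
    (hi : ∃ j, j < i) (h : ∀ j < i, ∃ k ∈ C, j < k ∧ k < i) : i ∈ C := by
  refine hC.isLUB_mem (t := C ∩ Set.Iio i) Set.inter_subset_left ?_ ⟨fun k hk => hk.2.le, ?_⟩
  · obtain ⟨j, hj⟩ := hi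
    obtain ⟨k, hk, -, hki⟩ := h j hj
    exact ⟨k, hk, hki⟩
  · intro b hb
    by_contra! hbi
    obtain ⟨k, hk, hbk, hki⟩ := h b hbi
    exact (hb ⟨hk, hki⟩).not_gt hbk

theorem cof_ne_aleph0 (hreg : κ.IsRegular) (hκ : ℵ₀ < κ) : Order.cof κ.ord.ToType ≠ ℵ₀ := by
  rw [Ordinal.cof_toType, hreg.cof_ord]
  exact hκ.ne'

theorem exists_model (hreg : κ.IsRegular) (hκ : ℵ₀ < κ) {o : Ordinal.{u}} (β : o.ToType)
    (hβ : ∃ x, x < β) {γ δ : Ordinal.{u}} (hγ : Ordinal.typein (α := o.ToType) (· < ·) β < γ)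
    (hδ : haveI := ltMod_nonstationary_isWellFounded hreg hκ o
      δ ≤ rankMod (nonstationaryIdeal κ) fun _ => β) :
    ∃ M : Theory.ModelType.{u, u, u} (ghTheory κ.ord.ToType), InEC (ghTypes κ.ord.ToType) M ∧
      OtpLT (ltOn (ltSym κ.ord.ToType) M (predSet (predSym κ.ord.ToType) M)) γ ∧
      OtpGE (ltOn (ltSym κ.ord.ToType) M (predSet (predSym κ.ord.ToType) M)ᶜ) δ := by
  classical
  have hwf := ltMod_nonstationary_isWellFounded hreg hκ o
  have hmax : NoMaxOrder κ.ord.ToType := Cardinal.noMaxOrder hκ.le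
  have hcof := cof_ne_aleph0 hreg hκ
  obtain ⟨x₀, hx₀⟩ := hβ
  let J := nonstationaryIdeal κ
  let A : Type u := Set.Iio β
  let B : Type u := δ.ToType
  let level : A ⊕ B → Ordinal.{u} := Sum.elim (fun _ => 0) (Ordinal.typein (α := B) (· < ·))
  -- The default `x₀` is needed since values may fail to lie below `β`; the empty sequence always
  -- has value `β`. This is why descent is only required from length 2 on.
  let val : ∀ n, κ.ord.ToType → (Fin n → A ⊕ B) → A := fun n i v =>
    if h : tree J β level n v i < β then ⟨_, h⟩ else ⟨x₀, hx₀⟩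
  let meets : ∀ n, κ.ord.ToType → κ.ord.ToType → (Fin n → A ⊕ B) → Prop := fun n j i v =>
    ∃ k ∈ clubOff (bad J β level n v), j < k ∧ k < i
  let str : (ghLang κ.ord.ToType).Structure (A ⊕ B) := ghStructure val meets
  have hlt : ∀ x y : A ⊕ B, ltRel (ltSym κ.ord.ToType) (A ⊕ B) x y ↔
      Sum.Lex (· < ·) (· < ·) x y := fun x y => Iff.rfl
  have hP : ∀ x : A ⊕ B, x ∈ predSet (predSym κ.ord.ToType) (A ⊕ B) ↔ x.isLeft :=
    fun x => Iff.rfl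
  have htot : IsStrictTotalOrder (A ⊕ B) (ltRel (ltSym κ.ord.ToType) (A ⊕ B)) :=
    inferInstanceAs (IsStrictTotalOrder (A ⊕ B) (Sum.Lex (· < ·) (· < ·)))
  have hne : Nonempty (A ⊕ B) := ⟨Sum.inl ⟨x₀, hx₀⟩⟩
  have hmod : (A ⊕ B) ⊨ ghTheory κ.ord.ToType := models_ghTheory_iff.2 htot
  refine ⟨Theory.ModelType.of _ (A ⊕ B), ?_, ?_, ?_⟩
  · rintro p (⟨n, j, rfl⟩ | ⟨n, j, k, k', hk, rfl⟩ | ⟨n, i, hi, rfl⟩)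
    · refine omits_unboundedType.2 fun v => ?_
      obtain ⟨j', hj'⟩ := exists_gt j
      obtain ⟨k, hk, hk'⟩ := (isClub_clubOff (bad J β level n v)).isCofinal j'
      obtain ⟨i, hi⟩ := exists_gt k
      exact ⟨i, k, hk, hj'.trans_le hk', hi⟩
    · refine omits_monoType.2 fun v => ?_
      rintro ⟨l, hl, hjl, hlk⟩
      exact ⟨l, hl, hjl, hlk.trans hk⟩
    · refine omits_descentType.2 fun v hv hvP hE => ?_
      have hlev : ∀ m, ∃ b : B, v m = Sum.inr b := fun m => by
        have := hvP m
        rcases h : v m with a | b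
        · exact absurd ((hP _).2 (by rw [h]; rfl)) this
        · exact ⟨b, rfl⟩
      choose b hb using hlev
      obtain rfl : v = fun m => Sum.inr (b m) := funext hb
      have hbad := (bad_mem (J := J) (level := level) (v := fun m => Sum.inr (b m)) (n := n + 2)
        not_isStationary_empty (fun s hs t ht => ?_) hδ ?_ fun m => ?_).1
      · have hiC : i ∈ clubOff (bad J β level (n + 2) fun m => Sum.inr (b m)) :=
          mem_of_isClub_of_forall_lt (isClub_clubOff _) hi hE
        have hib := Set.disjoint_right.1 (disjoint_clubOff hbad) hiC
        obtain ⟨hib', h1⟩ := tree_lt_of_notMem_bad hib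
        -- A second descent puts the value of the shorter sequence below `β` too, so neither value
        -- is the default.
        obtain ⟨hib'', h2⟩ := tree_lt_of_notMem_bad hib'
        have h3 := h2.trans_le (tree_le_of_notMem_bad hib'')
        refine ⟨rfl, (hlt _ _).2 (Sum.Lex.inl ?_)⟩
        have e1 : val (n + 2) i (fun m => Sum.inr (b m)) = ⟨_, h1.trans h3⟩ := dif_pos _
        have e2 : val (n + 1) i (Fin.init fun m => Sum.inr (b m)) = ⟨_, h3⟩ := dif_pos _
        change val (n + 2) i (fun m => Sum.inr (b m)) <
          val (n + 1) i (Fin.init fun m => Sum.inr (b m))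
        rw [e1, e2]
        exact h1
      · exact fun h => ((isStationary_union_iff hcof).1 h).elim hs ht
      · refine Fin.strictAnti_iff_succ_lt.2 fun m => ?_
        exact (Ordinal.typein_lt_typein _).2 (Sum.lex_inr_inr.1 ((hlt _ _).1 (hv m)))
      · exact Ordinal.typein_lt_self (b m)
  · let e : ((· < ·) : A → A → Prop) ≃r ltOn (ltSym κ.ord.ToType) (A ⊕ B)
        (predSet (predSym κ.ord.ToType) (A ⊕ B)) :=
      RelIso.ofSurjective ⟨⟨fun a => ⟨Sum.inl a, rfl⟩, fun a b hab =>
        Sum.inl_injective (congrArg Subtype.val hab)⟩, Sum.lex_inl_inl⟩ (by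
          rintro ⟨a | b, h⟩
          · exact ⟨a, rfl⟩
          · exact absurd ((hP _).1 h) (by simp))
    have hwo := e.symm.toRelEmbedding.isWellOrder
    exact ⟨hwo, e.ordinalType_congr.symm.trans_lt ((Ordinal.type_Iio_lt β).trans_lt hγ)⟩
  · let e : ((· < ·) : B → B → Prop) ≃r ltOn (ltSym κ.ord.ToType) (A ⊕ B)
        (predSet (predSym κ.ord.ToType) (A ⊕ B))ᶜ :=
      RelIso.ofSurjective ⟨⟨fun b => ⟨Sum.inr b, fun h => absurd ((hP _).1 h) (by simp)⟩,
        fun a b hab => Sum.inr_injective (congrArg Subtype.val hab)⟩, Sum.lex_inr_inr⟩ (by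
          rintro ⟨a | b, h⟩
          · exact absurd ((hP _).2 rfl) h
          · exact ⟨b, rfl⟩)
    have hwo := e.symm.toRelEmbedding.isWellOrder
    exact ⟨hwo, ((Ordinal.type_toType δ).symm.trans e.ordinalType_congr).le⟩

theorem not_deltaTwoProp (hreg : κ.IsRegular) (hκ : ℵ₀ < κ) (o : Ordinal.{u}) {γ δ : Ordinal.{u}}
    (h : haveI := ltMod_nonstationary_isWellFounded hreg hκ o
      ∀ δ' < δ, ∃ β : o.ToType, (∃ x, x < β) ∧ Ordinal.typein (α := o.ToType) (· < ·) β < γ ∧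
        δ' ≤ rankMod (nonstationaryIdeal κ) fun _ => β) :
    ¬ DeltaTwoProp κ γ κ δ := by
  intro hD
  have hI : #κ.ord.ToType ≤ κ := (mk_ord_toType κ).le
  obtain ⟨N, hN, ⟨hP, -⟩, hQ⟩ := hD (ghLang κ.ord.ToType) (ltSym _) (predSym _) (ghTheory _)
    (ghTypes _) (ghLang_card_le hκ.le hI) (card_ghTypes_le hκ.le hI)
    (fun M => models_ghTheory_iff.1 M.is_model) fun δ' hδ' => by
      obtain ⟨β, hβ, hγ, hr⟩ := h δ' hδ'
      exact exists_model hreg hκ β hβ hγ hr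
  exact hQ (isWellOrder_compl_of_inEC hreg hκ N hN hP)

/-- The infimum defining `δ₂` is attained, so it cannot be an ordinal at which the property fails.
The constant `β` may vary with `δ'`. -/
theorem lt_deltaTwo (hreg : κ.IsRegular) (hκ : ℵ₀ < κ) (o : Ordinal.{u}) {γ ρ : Ordinal.{u}}
    (h : haveI := ltMod_nonstationary_isWellFounded hreg hκ o
      ∀ δ' < ρ, ∃ β : o.ToType, (∃ x, x < β) ∧ Ordinal.typein (α := o.ToType) (· < ·) β < γ ∧
        δ' ≤ rankMod (nonstationaryIdeal κ) fun _ => β) :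
    ρ < deltaTwo γ κ := by
  by_contra! hle
  refine not_deltaTwoProp hreg hκ o (fun δ' hδ' => h δ' (hδ'.trans_le hle)) ?_
  exact csInf_mem (exists_deltaTwoProp hκ.le γ)

theorem rankMod_le_of_le (hreg : κ.IsRegular) (hκ : ℵ₀ < κ) {o : Ordinal.{u}}
    {f g : κ.ord.ToType → o.ToType} (h : ¬ IsStationary {i | ¬ f i ≤ g i}) :
    haveI := ltMod_nonstationary_isWellFounded hreg hκ o
    rankMod (nonstationaryIdeal κ) f ≤ rankMod (nonstationaryIdeal κ) g := by
  have := ltMod_nonstationary_isWellFounded hreg hκ o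
  refine le_of_forall_lt fun a ha => ?_
  obtain ⟨f', hf', hle⟩ := exists_le_rankMod ha
  refine hle.trans_lt (IsWellFounded.rank_lt_of_rel ?_)
  intro hst
  refine ((isStationary_union_iff (cof_ne_aleph0 hreg hκ)).1 (hst.mono ?_)).elim hf' h
  intro i hi
  by_contra hc
  simp only [Set.mem_union, Set.mem_ofPred_eq, not_or, not_not] at hc hi
  exact hi (hc.1.trans_le hc.2)

end Model

end GHBound

theorem mainTheorem6 (κ : Cardinal.{u}) (hreg : κ.IsRegular) (hκ : ℵ₀ < κ)
    (γ : Ordinal.{u}) (hγ : κ.ord < γ) :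
    GHBound.nonstationaryRank κ hreg hκ γ < GHBound.deltaTwo (Order.succ γ) κ ∧
      (((∃ β, γ = Order.succ β) ∨ κ < γ.cof) →
        GHBound.nonstationaryRank κ hreg hκ γ < GHBound.deltaTwo γ κ) := by
  have hwf := GHBound.ltMod_nonstationary_isWellFounded hreg hκ (Order.succ γ)
  let c : Set.Iio (Order.succ γ) → (Order.succ γ).ToType := Ordinal.ToType.mk
  have hc : ∀ x, Ordinal.typein (α := (Order.succ γ).ToType) (· < ·) (c x) = x := fun x =>
    congrArg Subtype.val (Ordinal.ToType.mk.symm_apply_apply x)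
  have hlt : ∀ {x y}, c x < c y ↔ x < y := Ordinal.ToType.mk.lt_iff_lt
  have hle : ∀ {x y}, c x ≤ c y ↔ x ≤ y := Ordinal.ToType.mk.le_iff_le
  have hγs : γ ∈ Set.Iio (Order.succ γ) := Order.lt_succ γ
  have hpos : ∀ x : Set.Iio (Order.succ γ), κ.ord ≤ x → ∃ y, y < c x := fun x hx => by
    have h0 : 0 < κ.ord := by
      rw [Cardinal.lt_ord]
      simpa using aleph0_pos.trans hκ
    exact ⟨c ⟨0, (h0.trans hγ).trans hγs⟩, hlt.2 (h0.trans_le hx)⟩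
  refine ⟨?_, fun hcase => ?_⟩
  · refine GHBound.lt_deltaTwo hreg hκ (Order.succ γ) fun δ' hδ' => ?_
    exact ⟨c ⟨γ, hγs⟩, hpos _ hγ.le, (hc _).trans_lt hγs, hδ'.le⟩
  · refine GHBound.lt_deltaTwo hreg hκ (Order.succ γ) fun δ' hδ' => ?_
    obtain ⟨g, hg, hδg⟩ := GHBound.exists_le_rankMod hδ'
    obtain ⟨x, rfl⟩ : ∃ x : κ.ord.ToType → Set.Iio (Order.succ γ), (fun i => c (x i)) = g :=
      ⟨fun i => Ordinal.ToType.mk.symm (g i),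
        funext fun i => Ordinal.ToType.mk.apply_symm_apply (g i)⟩
    -- A function below `γ` modulo `J` is bounded modulo `J` by a constant `b < γ`: the predecessor
    -- of `γ`, or a supremum of `κ` values. The constant `b` thus has rank at least `δ'`; `κ.ord ≤
    -- b` serves to make `b` nonzero.
    obtain ⟨b, hb, hκb, hxb⟩ : ∃ b < γ, κ.ord ≤ b ∧ ∀ i, (x i : Ordinal) < γ → x i ≤ b := by
      rcases hcase with ⟨β, rfl⟩ | hcof
      · exact ⟨β, Order.lt_succ β, Order.lt_succ_iff.1 hγ, fun i => Order.lt_succ_iff.1⟩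
      · let y : κ.ord.ToType → Ordinal.{u} := fun i => if (x i : Ordinal) < γ then x i else 0
        have hy : ∀ i, y i < γ := fun i => by
          simp only [y]
          split_ifs with h
          · exact h
          · exact bot_le.trans_lt hγ
        have hsup : ⨆ i, y i < γ := Ordinal.iSup_lt_of_lt_cof (by rwa [mk_ord_toType]) hy
        refine ⟨max κ.ord (⨆ i, y i), max_lt hγ hsup, le_max_left _ _, fun i hi => ?_⟩
        refine le_trans (le_of_eq ?_) ((Ordinal.le_iSup y i).trans (le_max_right _ _))
        simp only [y, if_pos hi]
    refine ⟨c ⟨b, hb.trans hγs⟩, hpos _ hκb, (hc _).trans_lt hb,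
      hδg.trans (GHBound.rankMod_le_of_le hreg hκ fun hst => hg (hst.mono fun i hi h => hi ?_))⟩
    exact hle.2 (hxb i (hlt.1 h))
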